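/- Let $\mathcal A$ be a finite alphabet with $n=|\mathcal A|\ge 2$ letters. For $T\ge 1$ let $\mathfrak g=\mathfrak g(T,n)=\mathfrak L/\mathfrak L^{T}$, where $\mathfrak L$ is the free real Lie algebra on generators $(e_a)_{a\in\mathcal A}$ and $\mathfrak L^{0}=\mathfrak L$, $\mathfrak L^{i+1}=[\mathfrak L,\mathfrak L^{i}]$ (so brackets of more than $T$ letters vanish and $\mathfrak g$ is nilpotent of class $T$). Let $\mathfrak g=\mathfrak g^{(0)}\supseteq\mathfrak g^{(1)}\supseteq\dots\supseteq\mathfrak g^{(k)}=0$ be its derived series, $k$ its derived length, $\pi_i:\mathfrak g^{(i)}\to\mathfrak g^{(i)}/\mathfrak g^{(i+1)}\cong\mathbb R^{d_i}$ the quotient maps and $s_i$ linear sections of them. Consider the deep state space model $\mathbf S_T$ obtained by decomposing the Lie equation $\dot\Psi=A(x)\Psi$, $A(x)=\sum_{a}x_a e_a$ (words of length at most $T$ being fed in as piecewise-constant inputs, the letter $a$ as the $a$-th unit vector), along this tower of abelian extensions: it has layers $i=0,\dots,k-1$, layer $i$ has state $h_i\in\mathbb R^{d_i}$ and the equation $\dot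 h_i=\pi_i(R_i)$, where $R_0=A(x)$ and, with $Q_i=\exp(s_i(h_i))$, $R_{i+1}=Q_i^{-1}R_iQ_i-Q_i^{-1}\dot Q_i\in\mathfrak g^{(i+1)}$, a function of the external input $x$ and of the states $h_0,\dots,h_i$ only; thus $\Psi=Q_0Q_1\cdots Q_{k-1}$ when $\Psi(0)=I$ and all $h_i(0)=0$. The input of layer $0$ is $x$, and layer $i\ge 1$ is the affine system $\dot h_i=x_i$ with input $x_i=\pi_i(R_i)$. Then the following hold. 1. For every $T\ge1$, $\mathbf S_T$ is abelian (in each layer the vector fields belonging to any two inputs commute), has at most $\lceil\log_2T\rceil+1$ layers, and its total state space dimension $\dim\mathbf S_T=\sum_{i}d_i$ is $$\dim \mathbf S_T=\sum_{m=1}^{T}\frac1m\sum_{d\mid m}n^{d}\,\mu\!\left(\frac md\right),$$ where $\mu$ is the Möbius function. 2. For fixed $\mathcal A$, the total state space dimension grows exponentially in $T$, with asymptotic order $n^T/T$: there is $c>1$ with $\dim\mathbf S_T\ge c^{T}$ for all sufficiently large $T$, and $\dim\mathbf S_T=\Theta(n^T/T)$ as $T\to\infty$; in particular $\dim\mathbf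 S_T=O(n^T/T)$. -/

import Mathlib

open scoped ContDiff BigOperators
open Asymptotics Filter

namespace StateSpace

/-! ### State space models and deep state space models -/

/-- A state space model with input space `ℝ^m` and state space `ℝ^d`: the family of affine vector
fields `F_x(h) = A(x) h + b(x)`, where the generator `A` and the translation `b` are real analytic
functions of the input. -/
structure SSM (m d : ℕ) where
  A : (Fin m → ℝ) → Matrix (Fin d) (Fin d) ℝ
  b : (Fin m → ℝ) → (Fin d → ℝ)
  analytic_A : ∀ i j, AnalyticOnNhd ℝ (fun x => A x i j) Set.univ
  analytic_b : ∀ i, AnalyticOnNhd ℝ (fun x => b x i) Set.univ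

namespace SSM

variable {m d : ℕ}

/-- The affine vector field of the model for a fixed input. -/
def vectorField (S : SSM m d) (x : Fin m → ℝ) (h : Fin d → ℝ) : Fin d → ℝ :=
  (S.A x).mulVec h + S.b x

/-- A model is abelian when its vector fields generate an abelian Lie algebra, that is, when any
two of them commute: `[F_x, F_y](h) = DF_y(h) F_x(h) - DF_x(h) F_y(h) = 0`, where the derivative
of `F_x` is the matrix `A(x)`. In particular the generators `A(x)` commute. -/
def IsAbelian (S : SSM m d) : Prop :=
  ∀ (x y : Fin m → ℝ) (h : Fin d → ℝ),
    (S.A y).mulVec (S.vectorField x h) = (S.A x).mulVec (S.vectorField y h)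

end SSM

/-- A deep state space model with layers `0, …, top`. Layer `i` has state space `ℝ^(dim i)` and is
driven by the input `x_i = v_i(h_0, …, h_{i-1}, x) ∈ ℝ^(inputDim i)`, where `v_i` is smooth and
`x ∈ ℝ^(inputDim 0)` is the external input, which is also the input of layer `0`:
`h_i' = A_i(x_i) h_i + b_i(x_i)`. -/
structure DeepSSM where
  top : ℕ
  dim : Fin (top + 1) → ℕ
  inputDim : Fin (top + 1) → ℕ
  layer : ∀ i, SSM (inputDim i) (dim i)
  v : ∀ i, ((∀ j : {j : Fin (top + 1) // j < i}, Fin (dim j) → ℝ) × (Fin (inputDim 0) → ℝ)) →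
    (Fin (inputDim i) → ℝ)
  smooth_v : ∀ i, ContDiff ℝ ∞ (v i)
  v_zero : ∀ z, v 0 z = z.2

namespace DeepSSM

/-- The number of layers. -/
def numLayers (D : DeepSSM) : ℕ := D.top + 1

/-- The total state space dimension: the dimension of the product of the state spaces. -/
def totalDim (D : DeepSSM) : ℕ := ∑ i, D.dim i

/-- A deep model is abelian when all of its layers are. -/
def IsAbelian (D : DeepSSM) : Prop := ∀ i, (D.layer i).IsAbelian

end DeepSSM

/-! ### The free nilpotent Lie algebra of class `T` -/

section FreeNilpotent

variable (𝒜 : Type*) (T : ℕ)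

/-- The quotient of the free real Lie algebra `𝔏` on the alphabet by the term `𝔏^T` of its lower
central series (`𝔏^0 = 𝔏`, `𝔏^(i+1) = [𝔏, 𝔏^i]`): brackets of more than `T` letters vanish. -/
abbrev FreeNilpotent : Type _ :=
  FreeLieAlgebra ℝ 𝒜 ⧸
    LieModule.lowerCentralSeries ℝ (FreeLieAlgebra ℝ 𝒜) (FreeLieAlgebra ℝ 𝒜) T

namespace FreeNilpotent

variable {𝒜}

/-- The generator labelled by a letter. -/
noncomputable def gen (a : 𝒜) : FreeNilpotent 𝒜 T :=
  LieSubmodule.Quotient.mk (FreeLieAlgebra.of ℝ a)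

variable {T}

/-- The right-normed bracket `[a₁, [a₂, […, [aₖ, a]]]]` in the free Lie algebra. -/
noncomputable def nestedBracket (a : 𝒜) : List 𝒜 → FreeLieAlgebra ℝ 𝒜
  | [] => FreeLieAlgebra.of ℝ a
  | c :: l => ⁅FreeLieAlgebra.of ℝ c, nestedBracket a l⁆

theorem lieSpan_of : LieSubalgebra.lieSpan ℝ (FreeLieAlgebra ℝ 𝒜)
    (Set.range (FreeLieAlgebra.of ℝ)) = ⊤ := by
  set S := LieSubalgebra.lieSpan ℝ (FreeLieAlgebra ℝ 𝒜) (Set.range (FreeLieAlgebra.of ℝ))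
  let f : FreeLieAlgebra ℝ 𝒜 →ₗ⁅ℝ⁆ S :=
    FreeLieAlgebra.lift ℝ fun a => ⟨FreeLieAlgebra.of ℝ a, LieSubalgebra.subset_lieSpan ⟨a, rfl⟩⟩
  have hf : S.incl.comp f = LieHom.id := by
    ext a
    simp [f]
  rw [eq_top_iff]
  intro x _
  have := LieHom.congr_fun hf x
  have h2 : ((f x : S) : FreeLieAlgebra ℝ 𝒜) = x := this
  rw [← h2]
  exact (f x).2

theorem span_nestedBracket : Submodule.span ℝ
    (Set.range fun p : 𝒜 × List 𝒜 => nestedBracket p.1 p.2) = ⊤ := by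
  set N := Submodule.span ℝ (Set.range fun p : 𝒜 × List 𝒜 => nestedBracket p.1 p.2) with hN
  have hgen : ∀ a : 𝒜, ∀ y ∈ N, ⁅FreeLieAlgebra.of ℝ a, y⁆ ∈ N := by
    intro a y hy
    induction hy using Submodule.span_induction with
    | mem y hy =>
      obtain ⟨p, rfl⟩ := hy
      exact Submodule.subset_span ⟨(p.1, a :: p.2), rfl⟩
    | zero => simp
    | add y z _ _ h1 h2 => rw [lie_add]; exact N.add_mem h1 h2
    | smul r y _ h1 => rw [lie_smul]; exact N.smul_mem r h1
  have key : ∀ x : FreeLieAlgebra ℝ 𝒜, x ∈ N ∧ ∀ y ∈ N, ⁅x, y⁆ ∈ N := by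
    intro x
    have hx : x ∈ LieSubalgebra.lieSpan ℝ (FreeLieAlgebra ℝ 𝒜)
        (Set.range (FreeLieAlgebra.of ℝ)) := by rw [lieSpan_of]; trivial
    induction hx using LieSubalgebra.lieSpan_induction with
    | mem x hx =>
      obtain ⟨a, rfl⟩ := hx
      exact ⟨Submodule.subset_span ⟨(a, []), rfl⟩, hgen a⟩
    | zero => exact ⟨N.zero_mem, fun y _ => by simp⟩
    | add x z _ _ h1 h2 =>
      exact ⟨N.add_mem h1.1 h2.1, fun y hy => by
        rw [add_lie]; exact N.add_mem (h1.2 y hy) (h2.2 y hy)⟩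
    | smul r x _ h1 =>
      exact ⟨N.smul_mem r h1.1, fun y hy => by rw [smul_lie]; exact N.smul_mem r (h1.2 y hy)⟩
    | lie x z _ _ h1 h2 =>
      exact ⟨h1.2 z h2.1, fun y hy => by
        rw [lie_lie]; exact N.sub_mem (h1.2 _ (h2.2 y hy)) (h2.2 _ (h1.2 y hy))⟩
  rw [eq_top_iff]
  exact fun x _ => (key x).1

theorem nestedBracket_mem (a : 𝒜) (l : List 𝒜) : nestedBracket a l ∈
    LieModule.lowerCentralSeries ℝ (FreeLieAlgebra ℝ 𝒜) (FreeLieAlgebra ℝ 𝒜) l.length := by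
  induction l with
  | nil => simp
  | cons c l ih =>
    rw [List.length_cons, LieModule.lowerCentralSeries_succ]
    exact LieSubmodule.lie_mem_lie (LieSubmodule.mem_top _) ih

instance finiteDimensional [Finite 𝒜] : FiniteDimensional ℝ (FreeNilpotent 𝒜 T) := by
  set I := LieModule.lowerCentralSeries ℝ (FreeLieAlgebra ℝ 𝒜) (FreeLieAlgebra ℝ 𝒜) T
  let q : FreeLieAlgebra ℝ 𝒜 →ₗ[ℝ] FreeNilpotent 𝒜 T := (LieSubmodule.Quotient.mk' I : _ →ₗ[ℝ] _)
  have hfin : Set.Finite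
      ((fun p : 𝒜 × List 𝒜 => q (nestedBracket p.1 p.2)) '' {p | p.2.length < T}) := by
    apply Set.Finite.image
    exact (Set.finite_univ.prod (List.finite_length_lt 𝒜 T)).subset fun p hp => ⟨trivial, hp⟩
  refine ⟨Submodule.fg_def.2 ⟨_, hfin, ?_⟩⟩
  rw [eq_top_iff]
  have htop : (⊤ : Submodule ℝ (FreeNilpotent 𝒜 T)) = Submodule.map q ⊤ := by
    rw [Submodule.map_top, LinearMap.range_eq_top.2]
    exact LieSubmodule.Quotient.surjective_mk' I
  rw [htop, ← span_nestedBracket, Submodule.map_span, Submodule.span_le]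
  rintro _ ⟨_, ⟨p, rfl⟩, rfl⟩
  by_cases hp : p.2.length < T
  · exact Submodule.subset_span ⟨p, hp, rfl⟩
  · have h1 : nestedBracket p.1 p.2 ∈ I :=
      LieModule.antitone_lowerCentralSeries ℝ _ _ (not_lt.1 hp) (nestedBracket_mem p.1 p.2)
    have h2 : q (nestedBracket p.1 p.2) = 0 := (LieSubmodule.Quotient.mk_eq_zero I).2 h1
    simp [h2]

end FreeNilpotent

end FreeNilpotent

/-! ### The cascade of abelian layers along the derived series -/

section Cascade

set_option linter.unusedSectionVars false

open FreeNilpotent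

variable (𝒜 : Type*) [Fintype 𝒜] (T : ℕ)

/-- The term `𝔤^(i)` of the derived series of the free nilpotent Lie algebra `𝔤`. -/
noncomputable def derivedTerm (i : ℕ) : Submodule ℝ (FreeNilpotent 𝒜 T) :=
  (LieAlgebra.derivedSeries ℝ (FreeNilpotent 𝒜 T) i).toSubmodule

/-- The abelian quotient `𝔤^(i) / 𝔤^(i+1)`. -/
abbrev LayerSpace (i : ℕ) : Type _ :=
  derivedTerm 𝒜 T i ⧸ (derivedTerm 𝒜 T (i + 1)).comap (derivedTerm 𝒜 T i).subtype

/-- The dimension of `𝔤^(i) / 𝔤^(i+1)`. -/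
noncomputable def layerDim (i : ℕ) : ℕ := Module.finrank ℝ (LayerSpace 𝒜 T i)

/-- The quotient map `𝔤^(i) → 𝔤^(i) / 𝔤^(i+1)`, in coordinates. -/
noncomputable def layerQuot (i : ℕ) : derivedTerm 𝒜 T i →ₗ[ℝ] (Fin (layerDim 𝒜 T i) → ℝ) :=
  (Module.finBasis ℝ (LayerSpace 𝒜 T i)).equivFun.toLinearMap ∘ₗ Submodule.mkQ _

theorem layerQuot_surjective (i : ℕ) : Function.Surjective (layerQuot 𝒜 T i) :=
  (Module.finBasis ℝ (LayerSpace 𝒜 T i)).equivFun.surjective.comp (Submodule.mkQ_surjective _)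

/-- A linear extension of the quotient map `𝔤^(i) → 𝔤^(i) / 𝔤^(i+1)` to `𝔤`; it is only used on
`𝔤^(i)` (see `remainder_mem`). -/
noncomputable def layerProj (i : ℕ) : FreeNilpotent 𝒜 T →ₗ[ℝ] (Fin (layerDim 𝒜 T i) → ℝ) :=
  (LinearMap.exists_extend (layerQuot 𝒜 T i)).choose

/-- A linear section `𝔤^(i) / 𝔤^(i+1) → 𝔤^(i) ⊆ 𝔤` of the quotient map. -/
noncomputable def layerSec (i : ℕ) : (Fin (layerDim 𝒜 T i) → ℝ) →ₗ[ℝ] FreeNilpotent 𝒜 T :=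
  (derivedTerm 𝒜 T i).subtype ∘ₗ
    ((layerQuot 𝒜 T i).exists_rightInverse_of_surjective
      (LinearMap.range_eq_top.2 (layerQuot_surjective 𝒜 T i))).choose

/-- The system `Ψ' = A(x) Ψ` to be simulated has generator `A(x) = ∑ₐ xₐ eₐ ∈ 𝔤`; the letter `a`
is the input signal with `xₐ = 1` and all other coordinates `0`. -/
noncomputable def generator : (Fin (Fintype.card 𝒜) → ℝ) →ₗ[ℝ] FreeNilpotent 𝒜 T :=
  ∑ a : 𝒜, (LinearMap.proj (Fintype.equivFin 𝒜 a)).smulRight (gen T a)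

variable {𝒜}

/-- `exp(-X) R exp(X) = ∑ₘ (-1)^m / m! (ad X)^m R`; the sum is finite since `𝔤` is nilpotent of
class `T`. -/
noncomputable def conjExp (X R : FreeNilpotent 𝒜 T) : FreeNilpotent 𝒜 T :=
  ∑ m ∈ Finset.range (T + 1), ((-1 : ℝ) ^ m / (m.factorial : ℝ)) •
    ((LieAlgebra.ad ℝ (FreeNilpotent 𝒜 T) X) ^ m) R

/-- The logarithmic derivative `exp(-X) (exp X)' = ∑ₘ (-1)^m / (m+1)! (ad X)^m Y` of the
exponential along a curve with velocity `X' = Y`. -/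
noncomputable def logDerivExp (X Y : FreeNilpotent 𝒜 T) : FreeNilpotent 𝒜 T :=
  ∑ m ∈ Finset.range (T + 1), ((-1 : ℝ) ^ m / ((m + 1).factorial : ℝ)) •
    ((LieAlgebra.ad ℝ (FreeNilpotent 𝒜 T) X) ^ m) Y

variable (𝒜)

/-- Write `Ψ = exp(X_0) exp(X_1) ⋯ exp(X_{i-1}) Ψ_i`, where `X_j = s_j(h_j)` for the section `s_j`
of `𝔤^(j) → 𝔤^(j) / 𝔤^(j+1)` and the state `h_j` of layer `j`. If `h_j' = π_j(R_j)` for all `j < i`,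
then `Ψ_i' = R_i Ψ_i`, where `R_0 = A(x)` and, with `Q_i = exp(X_i)`,
`R_{i+1} = Q_i⁻¹ R_i Q_i - Q_i⁻¹ Q_i'`. This is `R_i`, which depends only on `x` and on the `h_j`
with `j < i`, and lies in `𝔤^(i)`. -/
noncomputable def remainder (h : ∀ j, Fin (layerDim 𝒜 T j) → ℝ)
    (x : Fin (Fintype.card 𝒜) → ℝ) : ℕ → FreeNilpotent 𝒜 T
  | 0 => generator 𝒜 T x
  | i + 1 =>
    conjExp T (layerSec 𝒜 T i (h i)) (remainder h x i) -
      logDerivExp T (layerSec 𝒜 T i (h i))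
        (layerSec 𝒜 T i (layerProj 𝒜 T i (remainder h x i)))

theorem layerProj_apply (i : ℕ) (R : derivedTerm 𝒜 T i) :
    layerProj 𝒜 T i R = layerQuot 𝒜 T i R :=
  LinearMap.congr_fun (LinearMap.exists_extend (layerQuot 𝒜 T i)).choose_spec R

theorem layerSec_mem (i : ℕ) (h : Fin (layerDim 𝒜 T i) → ℝ) :
    layerSec 𝒜 T i h ∈ derivedTerm 𝒜 T i :=
  Submodule.coe_mem _

theorem layerQuot_layerSec (i : ℕ) (h : Fin (layerDim 𝒜 T i) → ℝ) :
    layerQuot 𝒜 T i ⟨layerSec 𝒜 T i h, layerSec_mem 𝒜 T i h⟩ = h :=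
  LinearMap.congr_fun ((layerQuot 𝒜 T i).exists_rightInverse_of_surjective
      (LinearMap.range_eq_top.2 (layerQuot_surjective 𝒜 T i))).choose_spec h

theorem sub_layerSec_mem (i : ℕ) {R : FreeNilpotent 𝒜 T} (hR : R ∈ derivedTerm 𝒜 T i) :
    R - layerSec 𝒜 T i (layerProj 𝒜 T i R) ∈ derivedTerm 𝒜 T (i + 1) := by
  have h1 : layerProj 𝒜 T i R = layerQuot 𝒜 T i ⟨R, hR⟩ := layerProj_apply 𝒜 T i ⟨R, hR⟩
  have h2 := layerQuot_layerSec 𝒜 T i (layerProj 𝒜 T i R)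
  have h3 : layerQuot 𝒜 T i (⟨R, hR⟩ - ⟨_, layerSec_mem 𝒜 T i (layerProj 𝒜 T i R)⟩) = 0 := by
    rw [map_sub, h2, h1, sub_self]
  have h4 := (Module.finBasis ℝ (LayerSpace 𝒜 T i)).equivFun.map_eq_zero_iff.1 h3
  rw [Submodule.mkQ_apply, Submodule.Quotient.mk_eq_zero] at h4
  exact h4

theorem lie_mem_derivedTerm (i : ℕ) {X Y : FreeNilpotent 𝒜 T} (hX : X ∈ derivedTerm 𝒜 T i)
    (hY : Y ∈ derivedTerm 𝒜 T i) : ⁅X, Y⁆ ∈ derivedTerm 𝒜 T (i + 1) := by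
  have : ⁅X, Y⁆ ∈ LieAlgebra.derivedSeries ℝ (FreeNilpotent 𝒜 T) (i + 1) := by
    rw [LieAlgebra.derivedSeries_def, LieAlgebra.derivedSeriesOfIdeal_succ]
    exact LieSubmodule.lie_mem_lie hX hY
  exact this

theorem derivedTerm_succ_le (i : ℕ) : derivedTerm 𝒜 T (i + 1) ≤ derivedTerm 𝒜 T i :=
  LieAlgebra.derivedSeriesOfIdeal_succ_le _ i

theorem ad_pow_mem (i : ℕ) {X Y : FreeNilpotent 𝒜 T} (hX : X ∈ derivedTerm 𝒜 T i)
    (hY : Y ∈ derivedTerm 𝒜 T i) (m : ℕ) :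
    ((LieAlgebra.ad ℝ (FreeNilpotent 𝒜 T) X) ^ (m + 1)) Y ∈ derivedTerm 𝒜 T (i + 1) := by
  induction m with
  | zero => simpa using lie_mem_derivedTerm 𝒜 T i hX hY
  | succ m ih =>
    rw [pow_succ', Module.End.mul_apply, LieAlgebra.ad_apply]
    exact lie_mem_derivedTerm 𝒜 T i hX (derivedTerm_succ_le 𝒜 T i ih)

theorem remainder_mem (h : ∀ j, Fin (layerDim 𝒜 T j) → ℝ) (x : Fin (Fintype.card 𝒜) → ℝ) (i : ℕ) :
    remainder 𝒜 T h x i ∈ derivedTerm 𝒜 T i := by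
  induction i with
  | zero => exact LieSubmodule.mem_top _
  | succ i ih =>
    have hX := layerSec_mem 𝒜 T i (h i)
    have hY := layerSec_mem 𝒜 T i (layerProj 𝒜 T i (remainder 𝒜 T h x i))
    rw [remainder, conjExp, logDerivExp, Finset.sum_range_succ', Finset.sum_range_succ',
      add_sub_add_comm]
    refine Submodule.add_mem _ (Submodule.sub_mem _ ?_ ?_) ?_
    · exact Submodule.sum_mem _ fun m _ => Submodule.smul_mem _ _ (ad_pow_mem 𝒜 T i hX ih m)
    · exact Submodule.sum_mem _ fun m _ => Submodule.smul_mem _ _ (ad_pow_mem 𝒜 T i hX hY m)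
    · simpa using sub_layerSec_mem 𝒜 T i ih

/-- The velocity `π_i(R_i)` of the state of layer `i`. -/
noncomputable def velocity (i : ℕ) (h : ∀ j, Fin (layerDim 𝒜 T j) → ℝ)
    (x : Fin (Fintype.card 𝒜) → ℝ) : Fin (layerDim 𝒜 T i) → ℝ :=
  layerProj 𝒜 T i (remainder 𝒜 T h x i)

variable {𝒜 T} in
/-- A function into `𝔤` is smooth when all its linear coordinates are. -/
def SmoothInto {E : Type*} [NormedAddCommGroup E] [NormedSpace ℝ E]
    (f : E → FreeNilpotent 𝒜 T) : Prop :=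
  ∀ l : FreeNilpotent 𝒜 T →ₗ[ℝ] ℝ, ContDiff ℝ ∞ fun z => l (f z)

namespace SmoothInto

variable {𝒜 T}
variable {E : Type*} [NormedAddCommGroup E] [NormedSpace ℝ E] {f g : E → FreeNilpotent 𝒜 T}

theorem sum_lie_eq {k : ℕ} (B : Fin k → FreeNilpotent 𝒜 T) (c e : Fin k → ℝ)
    (l : FreeNilpotent 𝒜 T →ₗ[ℝ] ℝ) :
    l ⁅∑ i, c i • B i, ∑ j, e j • B j⁆ = ∑ i, ∑ j, c i * (e j * l ⁅B i, B j⁆) := by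
  simp only [sum_lie, lie_sum, smul_lie, lie_smul, map_sum, map_smul, smul_eq_mul]
  exact Finset.sum_congr rfl fun i _ => Finset.sum_congr rfl fun j _ => mul_left_comm _ _ _

theorem lie (hf : SmoothInto f) (hg : SmoothInto g) : SmoothInto fun z => ⁅f z, g z⁆ := by
  intro l
  let B := Module.finBasis ℝ (FreeNilpotent 𝒜 T)
  have key : ∀ z, l ⁅f z, g z⁆ =
      ∑ i, ∑ j, B.coord i (f z) * (B.coord j (g z) * l ⁅B i, B j⁆) := by
    intro z
    conv_lhs => rw [← B.sum_repr (f z), ← B.sum_repr (g z)]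
    exact sum_lie_eq B _ _ l
  simp_rw [key]
  exact ContDiff.sum fun i _ => ContDiff.sum fun j _ =>
    (hf (B.coord i)).mul ((hg (B.coord j)).mul contDiff_const)

theorem ad_pow (hf : SmoothInto f) (hg : SmoothInto g) (m : ℕ) :
    SmoothInto fun z => ((LieAlgebra.ad ℝ (FreeNilpotent 𝒜 T) (f z)) ^ m) (g z) := by
  induction m with
  | zero => simpa using hg
  | succ m ih =>
    simp_rw [pow_succ', Module.End.mul_apply, LieAlgebra.ad_apply]
    exact hf.lie ih

theorem sum_smul {n : ℕ} {F : ℕ → E → FreeNilpotent 𝒜 T} (hF : ∀ m, SmoothInto (F m))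
    (c : ℕ → ℝ) : SmoothInto fun z => ∑ m ∈ Finset.range n, c m • F m z := by
  intro l
  simp only [map_sum, map_smul, smul_eq_mul]
  exact ContDiff.sum fun m _ => contDiff_const.mul (hF m l)

theorem comp_linear {k : ℕ} {u : E → Fin k → ℝ} (hu : ContDiff ℝ ∞ u)
    (L : (Fin k → ℝ) →ₗ[ℝ] FreeNilpotent 𝒜 T) : SmoothInto fun z => L (u z) := fun l =>
  (LinearMap.toContinuousLinearMap (l ∘ₗ L)).contDiff.comp hu

theorem proj {k : ℕ} (hf : SmoothInto f) (L : FreeNilpotent 𝒜 T →ₗ[ℝ] (Fin k → ℝ)) :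
    ContDiff ℝ ∞ fun z => L (f z) :=
  contDiff_pi.2 fun i => hf (LinearMap.proj i ∘ₗ L)

end SmoothInto

theorem smooth_remainder {E : Type*} [NormedAddCommGroup E] [NormedSpace ℝ E]
    {h : E → ∀ j, Fin (layerDim 𝒜 T j) → ℝ} {x : E → Fin (Fintype.card 𝒜) → ℝ}
    (hh : ∀ j, ContDiff ℝ ∞ fun z => h z j) (hx : ContDiff ℝ ∞ x) (i : ℕ) :
    SmoothInto fun z => remainder 𝒜 T (h z) (x z) i := by
  induction i with
  | zero => exact SmoothInto.comp_linear hx _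
  | succ i ih =>
    have hX : SmoothInto fun z => layerSec 𝒜 T i (h z i) := SmoothInto.comp_linear (hh i) _
    have hY : SmoothInto fun z =>
        layerSec 𝒜 T i (layerProj 𝒜 T i (remainder 𝒜 T (h z) (x z) i)) :=
      SmoothInto.comp_linear (ih.proj _) _
    intro l
    simp only [remainder, map_sub]
    exact (SmoothInto.sum_smul (fun m => hX.ad_pow ih m) _ l).sub
      (SmoothInto.sum_smul (fun m => hX.ad_pow hY m) _ l)

theorem smooth_velocity {E : Type*} [NormedAddCommGroup E] [NormedSpace ℝ E]
    {h : E → ∀ j, Fin (layerDim 𝒜 T j) → ℝ} {x : E → Fin (Fintype.card 𝒜) → ℝ}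
    (hh : ∀ j, ContDiff ℝ ∞ fun z => h z j) (hx : ContDiff ℝ ∞ x) (i : ℕ) :
    ContDiff ℝ ∞ fun z => velocity 𝒜 T i (h z) (x z) :=
  (smooth_remainder 𝒜 T hh hx i).proj _

/-- The layer `h' = L x` with zero generator, for a linear map `L`. -/
noncomputable def integratorSSM {m d : ℕ} (L : (Fin m → ℝ) →ₗ[ℝ] (Fin d → ℝ)) : SSM m d where
  A _ := 0
  b := L
  analytic_A _ _ := analyticOnNhd_const
  analytic_b i :=
    (LinearMap.toContinuousLinearMap ((LinearMap.proj i : (Fin d → ℝ) →ₗ[ℝ] ℝ) ∘ₗ L)).analyticOnNhd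
      Set.univ

/-- The states of the layers below layer `i`, extended by zero to all layers. -/
def extendPrefix {k : ℕ} (i : Fin (k + 1))
    (h : ∀ j : {j : Fin (k + 1) // j < i}, Fin (layerDim 𝒜 T j.1) → ℝ) (j : ℕ) :
    Fin (layerDim 𝒜 T j) → ℝ :=
  if hj : j < (i : ℕ) then h ⟨⟨j, hj.trans i.2⟩, hj⟩ else 0

/-- The deep model for words of length at most `T`. There is one layer for each step of the derived
series of the free nilpotent Lie algebra `𝔤` of class `T` on the alphabet; the state of layer `i`
is a point of the abelian group `𝔤^(i) / 𝔤^(i+1) ≅ ℝ^(layerDim i)`, and its equation is the abelian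
Lie equation of that quotient, `h_i' = x_i` with `x_i = π_i(R_i)` (`h_0' = π_0(A(x))` in layer
`0`). From the initial state `0` the flow `Ψ' = A(x) Ψ`, `Ψ(0) = I`, of the nilpotent group is
recovered as `Ψ = exp(s_0(h_0)) exp(s_1(h_1)) ⋯`. -/
noncomputable def wordSSM : DeepSSM where
  top := LieAlgebra.derivedLength ℝ (FreeNilpotent 𝒜 T) - 1
  dim i := layerDim 𝒜 T i
  inputDim := Fin.cases (Fintype.card 𝒜) fun j => layerDim 𝒜 T (j.val + 1)
  layer := Fin.cases (integratorSSM (layerProj 𝒜 T 0 ∘ₗ generator 𝒜 T))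
    fun _ => integratorSSM LinearMap.id
  v := Fin.cases (fun z => z.2)
    fun j z => velocity 𝒜 T (j.val + 1) (extendPrefix 𝒜 T j.succ z.1) z.2
  smooth_v := by
    refine Fin.cases contDiff_snd fun j => ?_
    refine smooth_velocity 𝒜 T (fun k => ?_) contDiff_snd _
    unfold extendPrefix
    split_ifs with hk
    · exact contDiff_pi.1 contDiff_fst _
    · exact contDiff_const
  v_zero _ := rfl

end Cascade

end StateSpace

/-!
The layers are integrators, so they commute; the substance is the dimension of the free nilpotent
Lie algebra `𝔤`. The layer dimensions telescope along the derived series to `dim 𝔤` (`sum_layerDim`,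
`totalDim_wordSSM`), and `𝔤^(k)` lies in the term `2 ^ k - 1` of the lower central series
(`derivedSeries_le_lowerCentralSeries_two_pow`), which bounds the number of layers.

Witt's formula for `dim 𝔤` is proved by Lazard elimination. Give the letters of an alphabet `X`
positive weights `w`, and consider the free Lie algebra `L(X)` modulo brackets of weight above `T`.
For a letter `x`, the elements `(ad x)^k y` with `k ≥ 0` and `y ≠ x` a letter freely generate a Lie
algebra complementary to `ℝ x`: `L(X) = ℝ x ⊕ L(Y)` with `Y = ℕ × (X \ {x})`. The map `L(Y) → L(X)`
is `expand`. It is injective because `L(X)` maps to the semidirect sum of `ℝ` and `L(Y)` in which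
`x` acts by the derivation `(k, y) ↦ (k + 1, y)` (`split`, `split_expand`). If `(k, y)` is given the
weight `k w(x) + w(y)`, the decomposition respects weights, so the elimination of a letter of weight
at most `T` lowers the dimension by exactly one (`finrank_quotient_eliminate`). Only finitely many
letters can be eliminated, and the dimension is their number.

The letters are counted through the series `u = 1 - ∑ t ^ w(a)`, for which elimination is the
factorization `u_X = (1 - t ^ w(x)) u_Y` (`alphabetSeries_eliminate`). Thus, with `ℓ i` eliminated
letters of weight `i`, `1 - n t` agrees with `∏ (1 - t ^ i) ^ ℓ i` up to degree `T`. The coefficients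
of `-t u' / u` give `∑_{i ∣ m} i ℓ i = n ^ m` for `m ≤ T` (`exists_finrank_eq_sum`,
`exists_totalDim_eq_sum`), and Möbius inversion gives the formula.

The growth follows from the same identity: `m ℓ m ≤ n ^ m`, while the proper divisors of `m`
contribute too little to bring `m ℓ m` below `n ^ m / 2` once `m ≥ 4` (`pow_le_two_mul`); the sum of
`n ^ m / m` over `m ≤ T` is dominated by its last term (`sum_pow_div_le`).
-/

namespace LazardElimination

/-! ### Derivations of a free Lie algebra -/

/-- The Lie algebra `L ⊕ εL` with `ε² = 0`. Its sections over `L` are the maps `z ↦ z + ε D z` with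
`D` a derivation of `L`. -/
@[ext] structure DualLie (L : Type*) where
  /-- The component in `L`. -/
  base : L
  /-- The coefficient of `ε`. -/
  eps : L

namespace DualLie

variable {L : Type*}

/-- The underlying product of `L ⊕ εL`. -/
def toProd : DualLie L ≃ L × L where
  toFun x := ⟨x.base, x.eps⟩
  invFun x := ⟨x.1, x.2⟩
  left_inv _ := rfl
  right_inv _ := rfl

variable [LieRing L]

noncomputable instance : AddCommGroup (DualLie L) := toProd.addCommGroup

instance : Bracket (DualLie L) (DualLie L) where
  bracket x y := ⟨⁅x.base, y.base⁆, ⁅x.base, y.eps⁆ + ⁅x.eps, y.base⁆⟩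

@[simp] theorem zero_base : (0 : DualLie L).base = 0 := rfl
@[simp] theorem zero_eps : (0 : DualLie L).eps = 0 := rfl
@[simp] theorem add_base (x y : DualLie L) : (x + y).base = x.base + y.base := rfl
@[simp] theorem add_eps (x y : DualLie L) : (x + y).eps = x.eps + y.eps := rfl
@[simp] theorem lie_base (x y : DualLie L) : ⁅x, y⁆.base = ⁅x.base, y.base⁆ := rfl
@[simp] theorem lie_eps (x y : DualLie L) :
    ⁅x, y⁆.eps = ⁅x.base, y.eps⁆ + ⁅x.eps, y.base⁆ := rfl

noncomputable instance : LieRing (DualLie L) where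
  add_lie x y z := by ext <;> simp; abel
  lie_add x y z := by ext <;> simp; abel
  lie_self x := by
    ext
    · simp
    · rw [lie_eps, ← lie_skew, neg_add_cancel, zero_eps]
  leibniz_lie x y z := by ext <;> simp; abel

variable [LieAlgebra ℝ L]

noncomputable instance : Module ℝ (DualLie L) := toProd.module ℝ

@[simp] theorem smul_base (c : ℝ) (x : DualLie L) : (c • x).base = c • x.base := rfl
@[simp] theorem smul_eps (c : ℝ) (x : DualLie L) : (c • x).eps = c • x.eps := rfl

noncomputable instance : LieAlgebra ℝ (DualLie L) where
  lie_smul c x y := by ext <;> simp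

/-- The projection `L ⊕ εL → L`. -/
def fst : DualLie L →ₗ⁅ℝ⁆ L where
  toFun := base
  map_add' _ _ := rfl
  map_smul' _ _ := rfl
  map_lie' := rfl

@[simp] theorem fst_apply (x : DualLie L) : fst x = x.base := rfl

end DualLie

section Derivation

variable {X : Type*} (δ : X → FreeLieAlgebra ℝ X)

/-- The section `z ↦ z + ε D z` attached to the derivation `D` with values `δ` on the letters. -/
noncomputable def dualLift : FreeLieAlgebra ℝ X →ₗ⁅ℝ⁆ DualLie (FreeLieAlgebra ℝ X) :=
  FreeLieAlgebra.lift ℝ fun a => ⟨FreeLieAlgebra.of ℝ a, δ a⟩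

theorem dualLift_base (z : FreeLieAlgebra ℝ X) : (dualLift δ z).base = z := by
  have h : DualLie.fst.comp (dualLift δ) = LieHom.id := by
    ext a
    simp [dualLift]
  exact LieHom.congr_fun h z

/-- The derivation of the free Lie algebra with prescribed values on the letters. -/
noncomputable def freeDerivation : LieDerivation ℝ (FreeLieAlgebra ℝ X) (FreeLieAlgebra ℝ X) where
  toFun z := (dualLift δ z).eps
  map_add' x y := by simp
  map_smul' c x := by simp
  leibniz' x y := by
    simp only [LinearMap.coe_mk, AddHom.coe_mk, LieHom.map_lie, DualLie.lie_eps, dualLift_base]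
    rw [← lie_skew y, sub_neg_eq_add]

@[simp] theorem freeDerivation_of (a : X) :
    freeDerivation δ (FreeLieAlgebra.of ℝ a) = δ a := by
  change (dualLift δ _).eps = _
  simp [dualLift]

end Derivation

/-- Induction on the elements of a free Lie algebra. -/
theorem free_induction {X : Type*} {P : FreeLieAlgebra ℝ X → Prop}
    (of : ∀ a, P (FreeLieAlgebra.of ℝ a)) (zero : P 0) (add : ∀ x y, P x → P y → P (x + y))
    (smul : ∀ (c : ℝ) x, P x → P (c • x)) (lie : ∀ x y, P x → P y → P ⁅x, y⁆)
    (x : FreeLieAlgebra ℝ X) : P x := by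
  have hx : x ∈ LieSubalgebra.lieSpan ℝ (FreeLieAlgebra ℝ X)
      (Set.range (FreeLieAlgebra.of ℝ)) := by
    rw [StateSpace.FreeNilpotent.lieSpan_of]; trivial
  induction hx using LieSubalgebra.lieSpan_induction with
  | mem x hx => obtain ⟨a, rfl⟩ := hx; exact of a
  | zero => exact zero
  | add x y _ _ hx hy => exact add x y hx hy
  | smul c x _ hx => exact smul c x hx
  | lie x y _ _ hx hy => exact lie x y hx hy

/-! ### The weight filtration -/

section Weight

variable {X : Type*} (w : X → ℕ)

/-- `HasWeight w a k`: the element `a` is a bracket of letters of total weight `k`. -/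
inductive HasWeight : FreeLieAlgebra ℝ X → ℕ → Prop
  | of (a : X) : HasWeight (FreeLieAlgebra.of ℝ a) (w a)
  | lie {a b : FreeLieAlgebra ℝ X} {i j : ℕ} :
      HasWeight a i → HasWeight b j → HasWeight ⁅a, b⁆ (i + j)

/-- The span of the brackets of total weight at least `k`. -/
noncomputable def weightFiltration (k : ℕ) : Submodule ℝ (FreeLieAlgebra ℝ X) :=
  Submodule.span ℝ {a | ∃ j, k ≤ j ∧ HasWeight w a j}

variable {w}

theorem HasWeight.mem {a : FreeLieAlgebra ℝ X} {j k : ℕ} (h : HasWeight w a j) (hk : k ≤ j) :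
    a ∈ weightFiltration w k :=
  Submodule.subset_span ⟨j, hk, h⟩

theorem weightFiltration_antitone : Antitone (weightFiltration w) := fun _ _ hij =>
  Submodule.span_mono fun _ ⟨k, hk, h⟩ => ⟨k, hij.trans hk, h⟩

theorem lie_mem_weightFiltration {a b : FreeLieAlgebra ℝ X} {i j : ℕ}
    (ha : a ∈ weightFiltration w i) (hb : b ∈ weightFiltration w j) :
    ⁅a, b⁆ ∈ weightFiltration w (i + j) := by
  induction ha using Submodule.span_induction with
  | mem a ha =>
    obtain ⟨i', hi, ha⟩ := ha
    induction hb using Submodule.span_induction with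
    | mem b hb =>
      obtain ⟨j', hj, hb⟩ := hb
      exact (ha.lie hb).mem (add_le_add hi hj)
    | zero => simp
    | add b c _ _ hb hc => rw [lie_add]; exact Submodule.add_mem _ hb hc
    | smul r b _ hb => rw [lie_smul]; exact Submodule.smul_mem _ _ hb
  | zero => simp
  | add b c _ _ hb hc => rw [add_lie]; exact Submodule.add_mem _ hb hc
  | smul r b _ hb => rw [smul_lie]; exact Submodule.smul_mem _ _ hb

open StateSpace.FreeNilpotent in
theorem hasWeight_nestedBracket (a : X) (l : List X) :
    HasWeight w (nestedBracket a l) ((l.map w).sum + w a) := by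
  induction l with
  | nil => simpa [nestedBracket] using HasWeight.of a
  | cons c l ih =>
    rw [nestedBracket, List.map_cons, List.sum_cons, add_assoc]
    exact (HasWeight.of c).lie ih

open StateSpace.FreeNilpotent in
theorem weightFiltration_eq_top {k : ℕ} (hk : ∀ a, k ≤ w a) : weightFiltration w k = ⊤ := by
  rw [eq_top_iff, ← span_nestedBracket, Submodule.span_le]
  rintro _ ⟨p, rfl⟩
  exact (hasWeight_nestedBracket p.1 p.2).mem ((hk p.1).trans (Nat.le_add_left _ _))

open StateSpace.FreeNilpotent in
/-- The right-normed brackets of small weight span, and positive weights leave finitely many. -/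
theorem finite_quotient (hw : ∀ a, 1 ≤ w a) (hfin : ∀ m, {a | w a ≤ m}.Finite) (k : ℕ) :
    Module.Finite ℝ (FreeLieAlgebra ℝ X ⧸ weightFiltration w k) := by
  set q := (weightFiltration w k).mkQ
  have hS : Set.Finite {p : X × List X | w p.1 ≤ k ∧ (p.2.map w).sum ≤ k} := by
    have hlist : Set.Finite {l : List X | (l.map w).sum ≤ k} := by
      have : Finite {a // w a ≤ k} := (hfin k).to_subtype
      refine ((List.finite_length_le {a // w a ≤ k} k).image (List.map Subtype.val)).subset ?_
      intro l hl
      have hl' : (l.map w).sum ≤ k := hl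
      have hmem : ∀ a ∈ l, w a ≤ k := fun a ha =>
        (List.single_le_sum (by simp) _ (List.mem_map_of_mem ha)).trans hl'
      refine ⟨l.attachWith _ hmem, ?_, by simp⟩
      have hlen : l.length ≤ (l.map w).sum := by
        have := List.card_nsmul_le_sum (l.map w) 1 (by simpa using fun a _ => hw a)
        simpa using this
      simpa using hlen.trans hl'
    exact ((hfin k).prod hlist).subset fun p hp => hp
  refine ⟨Submodule.fg_def.2 ⟨_, hS.image fun p => q (nestedBracket p.1 p.2), ?_⟩⟩
  have htop : (⊤ : Submodule ℝ (FreeLieAlgebra ℝ X ⧸ weightFiltration w k)) =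
      Submodule.map q ⊤ := by
    rw [Submodule.map_top, Submodule.range_mkQ]
  rw [eq_top_iff, htop, ← span_nestedBracket, Submodule.map_span, Submodule.span_le]
  rintro _ ⟨_, ⟨p, rfl⟩, rfl⟩
  by_cases hp : w p.1 ≤ k ∧ (p.2.map w).sum ≤ k
  · exact Submodule.subset_span ⟨p, hp, rfl⟩
  · have h1 : nestedBracket p.1 p.2 ∈ weightFiltration w k :=
      (hasWeight_nestedBracket p.1 p.2).mem (by omega)
    have h2 : q (nestedBracket p.1 p.2) = 0 := (Submodule.Quotient.mk_eq_zero _).2 h1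
    simp [h2]

end Weight

/-! ### Elimination of a letter -/

section Elimination

variable {X : Type*} (x : X)

/-- The alphabet left after the elimination of `x`: the letter `(k, y)` stands for `(ad x)^k y`. -/
abbrev Reduced : Type _ := ℕ × {y : X // y ≠ x}

/-- The derivation of the reduced free Lie algebra that becomes `ad x`: it maps the letter `(k, y)`
to `(k + 1, y)`. -/
noncomputable def shift :
    LieDerivation ℝ (FreeLieAlgebra ℝ (Reduced x)) (FreeLieAlgebra ℝ (Reduced x)) :=
  freeDerivation fun a => FreeLieAlgebra.of ℝ (a.1 + 1, a.2)

/-- The homomorphism that realizes the letter `(k, y)` as `(ad x)^k y`. -/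
noncomputable def expand : FreeLieAlgebra ℝ (Reduced x) →ₗ⁅ℝ⁆ FreeLieAlgebra ℝ X :=
  FreeLieAlgebra.lift ℝ fun a =>
    (fun z => ⁅FreeLieAlgebra.of ℝ x, z⁆)^[a.1] (FreeLieAlgebra.of ℝ a.2.1)

/-- Under `expand` the shift becomes `ad x`. -/
theorem expand_shift (z : FreeLieAlgebra ℝ (Reduced x)) :
    expand x (shift x z) = ⁅FreeLieAlgebra.of ℝ x, expand x z⁆ := by
  induction z using free_induction with
  | of a =>
    simp only [shift, freeDerivation_of, expand, FreeLieAlgebra.lift_of_apply]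
    rw [Function.iterate_succ_apply']
  | zero => simp
  | add y z hy hz => simp [hy, hz]
  | smul c y hy => simp [hy]
  | lie y z hy hz =>
    rw [LieDerivation.apply_lie_eq_add, map_add, LieHom.map_lie, LieHom.map_lie, hy, hz,
      LieHom.map_lie, leibniz_lie (FreeLieAlgebra.of ℝ x) (expand x y), add_comm]

/-- Every element is a multiple of `x` plus an element of the reduced free Lie algebra. -/
theorem exists_smul_add_expand (a : FreeLieAlgebra ℝ X) :
    ∃ (c : ℝ) (z : FreeLieAlgebra ℝ (Reduced x)),
      a = c • FreeLieAlgebra.of ℝ x + expand x z := by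
  induction a using free_induction with
  | of a =>
    by_cases h : a = x
    · exact ⟨1, 0, by simp [h]⟩
    · exact ⟨0, FreeLieAlgebra.of ℝ (0, ⟨a, h⟩), by simp [expand]⟩
  | zero => exact ⟨0, 0, by simp⟩
  | add a b ha hb =>
    obtain ⟨c, z, rfl⟩ := ha
    obtain ⟨d, y, rfl⟩ := hb
    exact ⟨c + d, z + y, by rw [map_add, add_smul]; abel⟩
  | smul r a ha =>
    obtain ⟨c, z, rfl⟩ := ha
    exact ⟨r * c, r • z, by rw [map_smul, mul_smul, smul_add]⟩
  | lie a b ha hb =>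
    obtain ⟨c, z, rfl⟩ := ha
    obtain ⟨d, y, rfl⟩ := hb
    refine ⟨0, c • shift x y - d • shift x z + ⁅z, y⁆, ?_⟩
    simp only [map_add, map_sub, map_smul, expand_shift, LieHom.map_lie, lie_add, add_lie,
      smul_lie, lie_smul, lie_self]
    rw [← lie_skew (expand x z) (FreeLieAlgebra.of ℝ x)]
    module

variable {w : X → ℕ}

variable (w) in
/-- The weight `k w(x) + w(y)` of the letter `(k, y)`, which stands for `(ad x)^k y`. -/
def reducedWeight (a : Reduced x) : ℕ := a.1 * w x + w a.2

variable {x} in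
theorem shift_mem {z : FreeLieAlgebra ℝ (Reduced x)} {k : ℕ}
    (hz : z ∈ weightFiltration (reducedWeight x w) k) :
    shift x z ∈ weightFiltration (reducedWeight x w) (k + w x) := by
  induction hz using Submodule.span_induction with
  | mem z hz =>
    obtain ⟨j, hj, hz⟩ := hz
    suffices h : shift x z ∈ weightFiltration (reducedWeight x w) (j + w x) from
      weightFiltration_antitone (by omega) h
    clear hj
    induction hz with
    | of a =>
      rw [shift, freeDerivation_of]
      exact (HasWeight.of _).mem (by simp only [reducedWeight]; linarith)
    | @lie a b i j ha hb iha ihb =>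
      rw [LieDerivation.apply_lie_eq_add]
      refine Submodule.add_mem _ ?_ ?_
      · exact weightFiltration_antitone (by omega) (lie_mem_weightFiltration (ha.mem le_rfl) ihb)
      · exact weightFiltration_antitone (by omega) (lie_mem_weightFiltration iha (hb.mem le_rfl))
  | zero => simp
  | add y z _ _ hy hz => rw [map_add]; exact Submodule.add_mem _ hy hz
  | smul c y _ hy => rw [map_smul]; exact Submodule.smul_mem _ _ hy

variable {x} in
theorem expand_mem {z : FreeLieAlgebra ℝ (Reduced x)} {k : ℕ}
    (hz : z ∈ weightFiltration (reducedWeight x w) k) : expand x z ∈ weightFiltration w k := by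
  induction hz using Submodule.span_induction with
  | mem z hz =>
    obtain ⟨j, hj, hz⟩ := hz
    refine HasWeight.mem (j := j) ?_ hj
    clear hj
    induction hz with
    | of a =>
      obtain ⟨k, y⟩ := a
      simp only [expand, FreeLieAlgebra.lift_of_apply, reducedWeight]
      induction k with
      | zero => simpa using HasWeight.of _
      | succ k ih =>
        rw [Function.iterate_succ_apply', show (k + 1) * w x + w y = w x + (k * w x + w y) by ring]
        exact (HasWeight.of x).lie ih
    | lie ha hb iha ihb => rw [LieHom.map_lie]; exact iha.lie ihb
  | zero => simp
  | add y z _ _ hy hz => rw [map_add]; exact Submodule.add_mem _ hy hz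
  | smul c y _ hy => rw [map_smul]; exact Submodule.smul_mem _ _ hy

attribute [local instance] LieRing.ofAssociativeRing

/-- The action of `ℝ` on the reduced free Lie algebra through the multiples of the shift. -/
noncomputable def shiftAction :
    ℝ →ₗ⁅ℝ⁆ LieDerivation ℝ (FreeLieAlgebra ℝ (Reduced x)) (FreeLieAlgebra ℝ (Reduced x)) where
  toFun c := c • shift x
  map_add' _ _ := add_smul _ _ _
  map_smul' _ _ := mul_smul _ _ _
  map_lie' {c d} := by
    rw [smul_lie, lie_smul, lie_self, smul_zero, smul_zero, Ring.lie_def, mul_comm, sub_self,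
      zero_smul]

/-- The homomorphism onto the semidirect sum in which `x` acts on the reduced free Lie algebra
by the shift. -/
noncomputable def split [DecidableEq X] :
    FreeLieAlgebra ℝ X →ₗ⁅ℝ⁆ LieAlgebra.SemiDirectSum _ ℝ (shiftAction x) :=
  FreeLieAlgebra.lift ℝ fun a =>
    if h : a = x then ⟨0, 1⟩ else ⟨FreeLieAlgebra.of ℝ (0, ⟨a, h⟩), 0⟩

variable [DecidableEq X]

theorem split_of_self : split x (FreeLieAlgebra.of ℝ x) = ⟨0, 1⟩ := by simp [split]

/-- The letter `(k, y)` is recovered from `(ad x)^k y`, so `expand` is injective. -/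
theorem split_expand (z : FreeLieAlgebra ℝ (Reduced x)) : split x (expand x z) = ⟨z, 0⟩ := by
  have h : (split x).comp (expand x) = LieAlgebra.SemiDirectSum.inl (shiftAction x) := by
    ext ⟨k, y⟩ : 1
    simp only [LieHom.comp_apply, expand, FreeLieAlgebra.lift_of_apply,
      LieAlgebra.SemiDirectSum.inl_eq_mk]
    induction k with
    | zero => simp [split, y.2]
    | succ k ih =>
      rw [Function.iterate_succ_apply', LieHom.map_lie, ih, split_of_self]
      ext
      · change ⁅(0 : FreeLieAlgebra ℝ (Reduced x)), FreeLieAlgebra.of ℝ (k, y)⁆ +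
          (1 : ℝ) • shift x (FreeLieAlgebra.of ℝ (k, y)) - (0 : ℝ) • shift x 0 = _
        simp [shift]
      · change ⁅(1 : ℝ), (0 : ℝ)⁆ = 0
        simp
  exact LieHom.congr_fun h z

variable {x}

/-- The splitting respects weights: a bracket of weight above `w x` has no component along `x`, and
its reduced part keeps its weight. -/
theorem split_mem_of_hasWeight {a : FreeLieAlgebra ℝ X} {j : ℕ} (ha : HasWeight w a j) :
    (split x a).left ∈ weightFiltration (reducedWeight x w) j ∧
      (w x < j → (split x a).right = 0) := by
  induction ha with
  | of a =>
    by_cases h : a = x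
    · subst h
      rw [split_of_self]
      exact ⟨Submodule.zero_mem _, fun h => absurd h (lt_irrefl _)⟩
    · have : split x (FreeLieAlgebra.of ℝ a) = ⟨FreeLieAlgebra.of ℝ (0, ⟨a, h⟩), 0⟩ := by
        simp [split, h]
      rw [this]
      exact ⟨(HasWeight.of _).mem (by simp [reducedWeight]), fun _ => rfl⟩
  | @lie a b i j _ _ iha ihb =>
    rw [LieHom.map_lie]
    generalize split x a = u at iha ⊢
    generalize split x b = v at ihb ⊢
    obtain ⟨s, c⟩ := u
    obtain ⟨t, d⟩ := v
    -- a nonzero multiple of `x` in a factor of weight `i` forces `i ≤ w x`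
    have aux : ∀ {u : FreeLieAlgebra ℝ (Reduced x)} {r : ℝ} {k l : ℕ},
        u ∈ weightFiltration (reducedWeight x w) k → (w x < l → r = 0) →
        r • shift x u ∈ weightFiltration (reducedWeight x w) (k + l) := by
      intro u r k l hu hr
      by_cases hl : w x < l
      · simp [hr hl]
      · exact Submodule.smul_mem _ _ (weightFiltration_antitone (by omega) (shift_mem hu))
    refine ⟨?_, fun _ => ?_⟩
    · change ⁅s, t⁆ + c • shift x t - d • shift x s ∈ _
      refine Submodule.sub_mem _ (Submodule.add_mem _ ?_ ?_) (aux iha.1 ihb.2)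
      · exact lie_mem_weightFiltration iha.1 ihb.1
      · rw [add_comm]; exact aux ihb.1 iha.2
    · change ⁅c, d⁆ = 0
      rw [Ring.lie_def, mul_comm, sub_self]

variable (x w) in
/-- The coefficient of `x`, together with the reduced part modulo weight `k`. -/
noncomputable def splitQuotient (k : ℕ) : FreeLieAlgebra ℝ X →ₗ[ℝ]
    ℝ × (FreeLieAlgebra ℝ (Reduced x) ⧸ weightFiltration (reducedWeight x w) k) :=
  LinearMap.prod
    ((LieAlgebra.SemiDirectSum.projr (shiftAction x)).toLinearMap ∘ₗ (split x).toLinearMap)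
    ((weightFiltration (reducedWeight x w) k).mkQ ∘ₗ
      LieAlgebra.SemiDirectSum.projl (shiftAction x) ∘ₗ (split x).toLinearMap)

theorem splitQuotient_smul_add_expand (k : ℕ) (c : ℝ) (z : FreeLieAlgebra ℝ (Reduced x)) :
    splitQuotient x w k (c • FreeLieAlgebra.of ℝ x + expand x z) =
      (c, (weightFiltration (reducedWeight x w) k).mkQ z) := by
  have h : split x (c • FreeLieAlgebra.of ℝ x + expand x z) = ⟨z, c⟩ := by
    rw [map_add, map_smul, split_of_self, split_expand]
    simp
  simp [splitQuotient, h]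

theorem ker_splitQuotient {k : ℕ} (hk : w x < k) :
    LinearMap.ker (splitQuotient x w k) = weightFiltration w k := by
  refine le_antisymm (fun a ha => ?_) ?_
  · obtain ⟨c, z, rfl⟩ := exists_smul_add_expand x a
    rw [LinearMap.mem_ker, splitQuotient_smul_add_expand, Prod.mk_eq_zero, Submodule.mkQ_apply,
      Submodule.Quotient.mk_eq_zero] at ha
    rw [ha.1, zero_smul, zero_add]
    exact expand_mem ha.2
  · rw [weightFiltration, Submodule.span_le]
    rintro a ⟨j, hj, ha⟩
    have h := split_mem_of_hasWeight (x := x) ha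
    change splitQuotient x w k a = 0
    refine Prod.ext (h.2 (hk.trans_le hj)) ?_
    exact (Submodule.Quotient.mk_eq_zero _).2 (weightFiltration_antitone hj h.1)

theorem splitQuotient_surjective (k : ℕ) : Function.Surjective (splitQuotient x w k) := by
  rintro ⟨c, q⟩
  obtain ⟨z, rfl⟩ := Submodule.mkQ_surjective _ q
  exact ⟨_, splitQuotient_smul_add_expand k c z⟩

/-- The elimination of a letter of weight below `k` lowers the dimension of the free Lie algebra
modulo weight `k` by one. -/
theorem finrank_quotient_eliminate {k : ℕ} (hk : w x < k)
    [Module.Finite ℝ (FreeLieAlgebra ℝ (Reduced x) ⧸ weightFiltration (reducedWeight x w) k)] :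
    Module.finrank ℝ (FreeLieAlgebra ℝ X ⧸ weightFiltration w k) =
      Module.finrank ℝ
        (FreeLieAlgebra ℝ (Reduced x) ⧸ weightFiltration (reducedWeight x w) k) + 1 := by
  rw [← ker_splitQuotient hk,
    ((splitQuotient x w k).quotKerEquivOfSurjective (splitQuotient_surjective k)).finrank_eq,
    Module.finrank_prod, Module.finrank_self, add_comm]

end Elimination

end LazardElimination

namespace LazardElimination

/-! ### The generating series of an alphabet -/

section Series

open PowerSeries

/-- The power series `-t u' / u`, which turns products into sums. For `u = ∏ (1 - αᵢ t)` its
coefficients are the power sums `∑ αᵢ ^ m`. -/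
noncomputable def powerSums (u : ℝ⟦X⟧) : ℝ⟦X⟧ := -(X * d⁄dX ℝ u * u⁻¹)

theorem powerSums_mul {u v : ℝ⟦X⟧} (hu : constantCoeff u ≠ 0) (hv : constantCoeff v ≠ 0) :
    powerSums (u * v) = powerSums u + powerSums v := by
  have h1 := PowerSeries.mul_inv_cancel u hu
  have h2 := PowerSeries.mul_inv_cancel v hv
  rw [powerSums, powerSums, powerSums, Derivation.leibniz, PowerSeries.mul_inv_rev, smul_eq_mul,
    smul_eq_mul]
  linear_combination (-X * d⁄dX ℝ v * v⁻¹) * h1 - (X * d⁄dX ℝ u * u⁻¹) * h2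

theorem coeff_X_mul_derivative (u : ℝ⟦X⟧) (m : ℕ) :
    coeff m (X * d⁄dX ℝ u) = m * coeff m u := by
  cases m with
  | zero => simp
  | succ m => rw [coeff_succ_X_mul, coeff_derivative]; push_cast; ring

theorem coeff_powerSums_one_sub_X_pow {p m : ℕ} (hp : 1 ≤ p) :
    coeff m (powerSums (1 - X ^ p)) = if p ∣ m ∧ m ≠ 0 then (p : ℝ) else 0 := by
  have h0 : constantCoeff (1 - X ^ p : ℝ⟦X⟧) ≠ 0 := by
    simp [(Nat.one_le_iff_ne_zero.1 hp)]
  suffices h : powerSums (1 - X ^ p) = mk fun m => if p ∣ m ∧ m ≠ 0 then (p : ℝ) else 0 by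
    rw [h, coeff_mk]
  rw [powerSums, ← neg_mul, eq_comm, PowerSeries.eq_mul_inv_iff_mul_eq h0]
  ext m
  rw [mul_sub, mul_one, map_sub, coeff_mul_X_pow', map_neg, coeff_X_mul_derivative, map_sub,
    coeff_X_pow, coeff_one, coeff_mk, coeff_mk]
  by_cases hm : p ≤ m
  · obtain ⟨r, rfl⟩ := Nat.exists_eq_add_of_le hm
    rcases Nat.eq_zero_or_pos r with rfl | hr
    · simp [Nat.one_le_iff_ne_zero.1 hp]
    · simp [hr.ne', Nat.one_le_iff_ne_zero.1 hp]
  · have h1 : ¬ (p ∣ m ∧ m ≠ 0) := fun h => hm (Nat.le_of_dvd (Nat.pos_of_ne_zero h.2) h.1)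
    have h2 : m ≠ p := by omega
    rw [if_neg h1, if_neg hm, if_neg h2]
    rcases Nat.eq_zero_or_pos m with rfl | hr
    · simp
    · simp [hr.ne']

theorem coeff_powerSums_one_sub_C_mul_X (c : ℝ) {m : ℕ} (hm : 1 ≤ m) :
    coeff m (powerSums (1 - C c * X)) = c ^ m := by
  have h0 : constantCoeff (1 - C c * X : ℝ⟦X⟧) ≠ 0 := by simp
  suffices h : powerSums (1 - C c * X) = mk fun m => if m = 0 then 0 else c ^ m by
    rw [h, coeff_mk, if_neg (by omega)]
  rw [powerSums, ← neg_mul, eq_comm, PowerSeries.eq_mul_inv_iff_mul_eq h0]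
  ext m
  rw [map_neg, coeff_X_mul_derivative, mul_sub, mul_one, map_sub, ← mul_assoc]
  rcases m with _ | _ | m
  · simp
  · rw [coeff_succ_mul_X]; simp [coeff_one]
  · rw [coeff_succ_mul_X, coeff_mul_C]
    simp [coeff_one, pow_succ]

theorem coeff_powerSums_eq_zero {u : ℝ⟦X⟧} {T : ℕ} (hu : ∀ m, 1 ≤ m → m ≤ T → coeff m u = 0)
    {m : ℕ} (hm : m ≤ T) : coeff m (powerSums u) = 0 := by
  have h : (X : ℝ⟦X⟧) ^ (T + 1) ∣ powerSums u := by
    rw [powerSums, dvd_neg]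
    refine Dvd.dvd.mul_right (X_pow_dvd_iff.2 fun k hk => ?_) _
    rw [coeff_X_mul_derivative]
    rcases Nat.eq_zero_or_pos k with rfl | hk'
    · simp
    · rw [hu k hk' (by omega), mul_zero]
  exact X_pow_dvd_iff.1 h m (by omega)

variable {X : Type*}

/-- The series `1 - ∑ t ^ w(a)`, summed over the letters `a`. -/
noncomputable def alphabetSeries (w : X → ℕ) : ℝ⟦X⟧ :=
  1 - mk fun m => ({a | w a = m}.ncard : ℝ)

theorem constantCoeff_alphabetSeries {w : X → ℕ} (hw : ∀ a, 1 ≤ w a) :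
    constantCoeff (alphabetSeries w) = 1 := by
  have : {a | w a = 0} = ∅ := by
    ext a
    have := hw a
    simp
    omega
  rw [alphabetSeries, map_sub, map_one, ← coeff_zero_eq_constantCoeff_apply, coeff_mk, this]
  simp

theorem reducedWeight_pos {x : X} {w : X → ℕ} (hw : ∀ a, 1 ≤ w a) (a : Reduced x) :
    1 ≤ reducedWeight x w a :=
  (hw a.2).trans (Nat.le_add_left _ _)

theorem finite_reducedWeight_le {x : X} {w : X → ℕ} (hw : ∀ a, 1 ≤ w a)
    (hfin : ∀ m, {a | w a ≤ m}.Finite) (m : ℕ) : {a | reducedWeight x w a ≤ m}.Finite := by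
  refine ((Set.finite_Iic m).prod ((hfin m).preimage Subtype.val_injective.injOn)).subset ?_
  rintro ⟨k, y⟩ h
  have h' : k * w x + w y ≤ m := h
  have := Nat.le_mul_of_pos_right k (hw x)
  exact ⟨show k ≤ m by omega, show w y ≤ m by omega⟩

/-- The letters of the reduced alphabet are the `(0, y)` with `y ≠ x` and the shifts of all of its
letters by `w x`, which gives the factorization. -/
theorem alphabetSeries_eliminate (x : X) {w : X → ℕ} (hw : ∀ a, 1 ≤ w a)
    (hfin : ∀ m, {a | w a ≤ m}.Finite) :
    alphabetSeries w = (1 - PowerSeries.X ^ w x) * alphabetSeries (reducedWeight x w) := by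
  have hfY := finite_reducedWeight_le (x := x) hw hfin
  have hX : ∀ m, {a | w a = m}.ncard =
      {y : {y // y ≠ x} | w y = m}.ncard + if m = w x then 1 else 0 := by
    intro m
    have h1 : {a | w a = m} =
        Subtype.val '' {y : {y // y ≠ x} | w y = m} ∪ (if m = w x then {x} else ∅) := by
      ext a
      by_cases ha : a = x
      · subst ha
        split_ifs with h <;> simp [h, eq_comm]
      · split_ifs <;> simp [ha]
    rw [h1, Set.ncard_union_eq ?_ ?_ ?_, Set.ncard_image_of_injective _ Subtype.val_injective]
    · split_ifs <;> simp
    · split_ifs <;> simp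
    · exact (((hfin m).subset fun a ha => le_of_eq ha).preimage Subtype.val_injective.injOn).image _
    · split_ifs <;> simp
  have hY : ∀ m, {a | reducedWeight x w a = m}.ncard = {y : {y // y ≠ x} | w y = m}.ncard +
      if w x ≤ m then {a | reducedWeight x w a = m - w x}.ncard else 0 := by
    intro m
    have h1 : {a | reducedWeight x w a = m} = Prod.mk 0 '' {y : {y // y ≠ x} | w y = m} ∪
        (if w x ≤ m then (Prod.map Nat.succ id) '' {a | reducedWeight x w a = m - w x} else ∅) := by
      ext ⟨k, y⟩
      cases k with
      | zero => split_ifs <;> simp [reducedWeight]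
      | succ k =>
        have hk : (k + 1) * w x + w y = k * w x + w y + w x := by ring
        split_ifs with h
        · simp only [reducedWeight, hk, Set.mem_ofPred_eq, Set.mem_union, Set.mem_image]
          constructor
          · exact fun e => Or.inr ⟨(k, y), by simp only; omega, rfl⟩
          · rintro (⟨_, _, e⟩ | ⟨⟨l, z⟩, e, e'⟩)
            · simp at e
            · simp only [Prod.map_apply, id_eq, Prod.mk.injEq, Nat.succ.injEq] at e e'
              obtain ⟨rfl, rfl⟩ := e'
              omega
        · simp only [reducedWeight, hk, Set.mem_ofPred_eq, Set.union_empty, Set.mem_image]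
          constructor
          · intro e
            omega
          · rintro ⟨_, _, e⟩
            simp at e
    rw [h1, Set.ncard_union_eq ?_ ?_ ?_, Set.ncard_image_of_injective _ (Prod.mk_right_injective 0)]
    · split_ifs
      · rw [Set.ncard_image_of_injective _ (Nat.succ_injective.prodMap Function.injective_id)]
      · simp
    · rw [Set.disjoint_left]
      rintro _ ⟨y, _, rfl⟩ h
      split_ifs at h
      · obtain ⟨⟨k, z⟩, _, h⟩ := h
        simp at h
      · exact h
    · exact (((hfin m).subset fun a ha => le_of_eq ha).preimage Subtype.val_injective.injOn).image _
    · split_ifs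
      · exact ((hfY _).subset fun a ha => le_of_eq ha).image _
      · exact Set.finite_empty
  ext m
  rw [alphabetSeries, alphabetSeries, sub_mul, one_mul, map_sub, map_sub, map_sub,
    coeff_X_pow_mul', coeff_mk, coeff_mk, map_sub, coeff_mk, hX, coeff_one]
  have hYm := congrArg (Nat.cast (R := ℝ)) (hY m)
  push_cast at hYm ⊢
  rw [hYm, coeff_one]
  by_cases h : w x ≤ m
  · rcases h.eq_or_lt with h' | h'
    · subst h'; simp; ring
    · rw [if_pos h, if_neg (show m ≠ w x by omega), if_pos h, if_neg (show m - w x ≠ 0 by omega)]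
      ring
  · rw [if_neg h, if_neg (show m ≠ w x by omega), if_neg h]
    ring

end Series

/-! ### The dimension of the truncated free Lie algebra -/

/-- The dimension of the free Lie algebra modulo weight above `T` is the number of letters that can
be eliminated; `ℓ i` of them have weight `i`, and the power sums of the alphabet add up from those
of the factors `1 - t ^ i`. -/
theorem exists_finrank_eq_sum.{u} (T d : ℕ) : ∀ (X : Type u) (w : X → ℕ), (∀ a, 1 ≤ w a) →
    (∀ m, {a | w a ≤ m}.Finite) →
    Module.finrank ℝ (FreeLieAlgebra ℝ X ⧸ weightFiltration w (T + 1)) = d →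
    ∃ ℓ : ℕ → ℕ, d = ∑ i ∈ Finset.Icc 1 T, ℓ i ∧ ∀ m ∈ Finset.Icc 1 T,
      ∑ i ∈ m.divisors, (i : ℝ) * ℓ i = PowerSeries.coeff m (powerSums (alphabetSeries w)) := by
  classical
  induction d with
  | zero =>
    intro X w hw hfin hd
    have hlarge : ∀ a, T < w a := by
      by_contra! h
      obtain ⟨x, hx⟩ := h
      have := finite_quotient (reducedWeight_pos (x := x) hw) (finite_reducedWeight_le hw hfin)
        (T + 1)
      rw [finrank_quotient_eliminate (x := x) (by omega)] at hd
      omega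
    refine ⟨0, by simp, fun m hm => ?_⟩
    rw [Finset.mem_Icc] at hm
    rw [coeff_powerSums_eq_zero (T := T) (fun k hk1 hk => ?_) hm.2]
    · simp
    · have : {a | w a = k} = ∅ := by
        ext a
        have := hlarge a
        simp
        omega
      simp [alphabetSeries, PowerSeries.coeff_one, this]
      omega
  | succ d ih =>
    intro X w hw hfin hd
    obtain ⟨x, hx⟩ : ∃ x, w x ≤ T := by
      by_contra! h
      rw [weightFiltration_eq_top fun a => h a] at hd
      rw [Module.finrank_zero_of_subsingleton] at hd
      omega
    have hwY := reducedWeight_pos (x := x) hw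
    have hfY := finite_reducedWeight_le (x := x) hw hfin
    have := finite_quotient hwY hfY (T + 1)
    rw [finrank_quotient_eliminate (x := x) (by omega)] at hd
    obtain ⟨ℓ, hℓ, hsum⟩ := ih _ _ hwY hfY (by omega)
    refine ⟨ℓ + Pi.single (w x) 1, ?_, fun m hm => ?_⟩
    · simp only [Pi.add_apply, Finset.sum_add_distrib, ← hℓ]
      rw [Finset.sum_pi_single', if_pos (Finset.mem_Icc.2 ⟨hw x, hx⟩)]
    · have hp : PowerSeries.constantCoeff (1 - PowerSeries.X ^ w x : PowerSeries ℝ) ≠ 0 := by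
        simp [Nat.one_le_iff_ne_zero.1 (hw x)]
      rw [alphabetSeries_eliminate x hw hfin,
        powerSums_mul hp (by rw [constantCoeff_alphabetSeries hwY]; exact one_ne_zero), map_add,
        ← hsum m hm, coeff_powerSums_one_sub_X_pow (hw x), add_comm]
      simp only [Pi.add_apply, Nat.cast_add, mul_add, Finset.sum_add_distrib]
      congr 1
      simp [Pi.single_apply, Nat.mem_divisors]

end LazardElimination

namespace LazardElimination

/-! ### The lower central and derived series -/

section LowerCentral

variable {L : Type*} [LieRing L] [LieAlgebra ℝ L]

theorem lie_mem_lowerCentralSeries {a b : L} {i j : ℕ}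
    (ha : a ∈ LieModule.lowerCentralSeries ℝ L L i)
    (hb : b ∈ LieModule.lowerCentralSeries ℝ L L j) :
    ⁅a, b⁆ ∈ LieModule.lowerCentralSeries ℝ L L (i + j + 1) := by
  induction i generalizing a b j with
  | zero =>
    rw [zero_add, LieModule.lowerCentralSeries_succ]
    exact LieSubmodule.lie_mem_lie (LieSubmodule.mem_top _) hb
  | succ i ih =>
    rw [LieModule.lowerCentralSeries_succ, ← LieSubmodule.mem_toSubmodule,
      LieSubmodule.lieIdeal_oper_eq_linear_span'] at ha
    induction ha using Submodule.span_induction with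
    | mem a ha =>
      obtain ⟨x, -, y, hy, rfl⟩ := ha
      rw [lie_lie]
      refine sub_mem ?_ ?_
      · rw [show i + 1 + j + 1 = (i + j + 1) + 1 by omega, LieModule.lowerCentralSeries_succ]
        exact LieSubmodule.lie_mem_lie (LieSubmodule.mem_top _) (ih hy hb)
      · rw [show i + 1 + j + 1 = i + (j + 1) + 1 by omega]
        refine ih hy ?_
        rw [LieModule.lowerCentralSeries_succ]
        exact LieSubmodule.lie_mem_lie (LieSubmodule.mem_top _) hb
    | zero => simp
    | add a c _ _ ha hc => rw [add_lie]; exact add_mem ha hc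
    | smul r a _ ha => rw [smul_lie]; exact SMulMemClass.smul_mem _ ha

theorem derivedSeries_le_lowerCentralSeries_two_pow (k : ℕ) :
    LieAlgebra.derivedSeries ℝ L k ≤ LieModule.lowerCentralSeries ℝ L L (2 ^ k - 1) := by
  induction k with
  | zero => simp
  | succ k ih =>
    rw [LieAlgebra.derivedSeries_def, LieAlgebra.derivedSeriesOfIdeal_succ, LieSubmodule.lie_le_iff]
    intro x hx y hy
    have := lie_mem_lowerCentralSeries (ih hx) (ih hy)
    have h2 : 2 ^ k - 1 + (2 ^ k - 1) + 1 = 2 ^ (k + 1) - 1 := by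
      have := Nat.one_le_two_pow (n := k)
      rw [pow_succ]
      omega
    rwa [h2] at this

end LowerCentral

section Free

variable {X : Type*}

/-- With all letters of weight one, the weight filtration is the lower central series. -/
theorem weightFiltration_one_eq (T : ℕ) : weightFiltration (fun _ : X => 1) (T + 1) =
    (LieModule.lowerCentralSeries ℝ (FreeLieAlgebra ℝ X) (FreeLieAlgebra ℝ X) T).toSubmodule := by
  refine le_antisymm ?_ ?_
  · rw [weightFiltration, Submodule.span_le]
    rintro a ⟨j, hj, ha⟩
    suffices h : 1 ≤ j ∧ a ∈ LieModule.lowerCentralSeries ℝ (FreeLieAlgebra ℝ X)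
        (FreeLieAlgebra ℝ X) (j - 1) from
      LieModule.antitone_lowerCentralSeries ℝ _ _ (by omega) h.2
    clear hj
    induction ha with
    | of a => exact ⟨le_rfl, by simp⟩
    | @lie a b i j _ _ iha ihb =>
      refine ⟨by omega, ?_⟩
      rw [show i + j - 1 = (i - 1) + (j - 1) + 1 by omega]
      exact lie_mem_lowerCentralSeries iha.2 ihb.2
  · induction T with
    | zero => rw [weightFiltration_eq_top fun _ => le_rfl]; exact le_top
    | succ T ih =>
      rw [LieModule.lowerCentralSeries_succ, LieSubmodule.lieIdeal_oper_eq_linear_span',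
        Submodule.span_le]
      rintro _ ⟨x, -, y, hy, rfl⟩
      rw [SetLike.mem_coe, add_comm]
      refine lie_mem_weightFiltration ?_ (ih hy)
      rw [weightFiltration_eq_top fun _ => le_rfl]
      trivial

end Free

/-! ### The free nilpotent Lie algebra and its cascade -/

section Cascade

open StateSpace

variable (𝒜 : Type*) (T : ℕ)

theorem derivedSeries_freeNilpotent_eq_bot {k : ℕ} (hk : T + 1 ≤ 2 ^ k) :
    LieAlgebra.derivedSeries ℝ (FreeNilpotent 𝒜 T) k = ⊥ := by
  rw [eq_bot_iff]
  set I := LieModule.lowerCentralSeries ℝ (FreeLieAlgebra ℝ 𝒜) (FreeLieAlgebra ℝ 𝒜) T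
  refine (derivedSeries_le_lowerCentralSeries_two_pow k).trans
    ((LieModule.antitone_lowerCentralSeries ℝ _ _ (show T ≤ 2 ^ k - 1 by omega)).trans ?_)
  rw [← LieSubmodule.toSubmodule_le_toSubmodule, ← coe_lowerCentralSeries_ideal_quot_eq,
    ← LieModule.map_lowerCentralSeries_eq _ (LieSubmodule.Quotient.surjective_mk' I),
    (LieSubmodule.Quotient.map_mk'_eq_bot_le I _).2 le_rfl]
  exact le_rfl

theorem derivedSeries_derivedLength :
    LieAlgebra.derivedSeries ℝ (FreeNilpotent 𝒜 T)
      (LieAlgebra.derivedLength ℝ (FreeNilpotent 𝒜 T)) = ⊥ :=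
  Nat.sInf_mem (s := {k | LieAlgebra.derivedSeriesOfIdeal ℝ (FreeNilpotent 𝒜 T) k ⊤ = ⊥})
    ⟨T, derivedSeries_freeNilpotent_eq_bot 𝒜 T Nat.lt_two_pow_self⟩

variable [Fintype 𝒜]

/-- The dimensions of the steps of the derived series add up to the dimension of the algebra. -/
theorem sum_layerDim (k : ℕ) : ∑ i ∈ Finset.range k, layerDim 𝒜 T i +
    Module.finrank ℝ (derivedTerm 𝒜 T k) = Module.finrank ℝ (FreeNilpotent 𝒜 T) := by
  induction k with
  | zero =>
    have : derivedTerm 𝒜 T 0 = ⊤ := rfl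
    rw [this, Finset.range_zero, Finset.sum_empty, zero_add, finrank_top]
  | succ k ih =>
    rw [← ih, Finset.sum_range_succ, add_assoc, add_left_cancel_iff, layerDim,
      ← Submodule.finrank_quotient_add_finrank
        ((derivedTerm 𝒜 T (k + 1)).comap (derivedTerm 𝒜 T k).subtype),
      (Submodule.comapSubtypeEquivOfLe (derivedTerm_succ_le 𝒜 T k)).finrank_eq]

theorem totalDim_wordSSM :
    (wordSSM 𝒜 T).totalDim = Module.finrank ℝ (FreeNilpotent 𝒜 T) := by
  set k := LieAlgebra.derivedLength ℝ (FreeNilpotent 𝒜 T)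
  have h : derivedTerm 𝒜 T (k - 1 + 1) = ⊥ := by
    have h1 : LieAlgebra.derivedSeries ℝ (FreeNilpotent 𝒜 T) (k - 1 + 1) = ⊥ := by
      rw [eq_bot_iff, ← derivedSeries_derivedLength 𝒜 T]
      exact LieAlgebra.derivedSeriesOfIdeal_antitone _ (by omega)
    rw [derivedTerm, h1, LieSubmodule.bot_toSubmodule]
  rw [← sum_layerDim 𝒜 T (k - 1 + 1), h, finrank_bot, add_zero, Finset.sum_range]
  rfl

theorem numLayers_wordSSM_le (hT : 1 ≤ T) : (wordSSM 𝒜 T).numLayers ≤ Nat.clog 2 T + 1 := by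
  have h : LieAlgebra.derivedLength ℝ (FreeNilpotent 𝒜 T) ≤ Nat.clog 2 T + 1 := by
    refine Nat.sInf_le (derivedSeries_freeNilpotent_eq_bot 𝒜 T ?_)
    have := Nat.le_pow_clog (b := 2) (by norm_num) T
    rw [pow_succ]
    omega
  change LieAlgebra.derivedLength ℝ (FreeNilpotent 𝒜 T) - 1 + 1 ≤ _
  omega

theorem isAbelian_integratorSSM {m d : ℕ} (L : (Fin m → ℝ) →ₗ[ℝ] (Fin d → ℝ)) :
    (integratorSSM L).IsAbelian := by
  intro x y h
  simp [integratorSSM]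

theorem isAbelian_wordSSM : (wordSSM 𝒜 T).IsAbelian := by
  intro i
  induction i using Fin.cases with
  | zero => exact isAbelian_integratorSSM _
  | succ j => exact isAbelian_integratorSSM _

/-- The dimension of the free nilpotent Lie algebra, through the numbers `ℓ i` of eliminated letters
of weight `i`. -/
theorem exists_totalDim_eq_sum : ∃ ℓ : ℕ → ℕ, (wordSSM 𝒜 T).totalDim = ∑ i ∈ Finset.Icc 1 T, ℓ i ∧
    ∀ m ∈ Finset.Icc 1 T, ∑ i ∈ m.divisors, (i : ℝ) * ℓ i = (Fintype.card 𝒜 : ℝ) ^ m := by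
  have hrank : Module.finrank ℝ
      (FreeLieAlgebra ℝ 𝒜 ⧸ weightFiltration (fun _ : 𝒜 => 1) (T + 1)) =
        (wordSSM 𝒜 T).totalDim := by
    rw [totalDim_wordSSM, weightFiltration_one_eq]
    rfl
  obtain ⟨ℓ, hℓ, hsum⟩ := exists_finrank_eq_sum T _ 𝒜 (fun _ => 1) (fun _ => le_rfl)
    (fun _ => Set.toFinite _) hrank
  refine ⟨ℓ, hℓ, fun m hm => ?_⟩
  rw [hsum m hm, ← coeff_powerSums_one_sub_C_mul_X _ (Finset.mem_Icc.1 hm).1]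
  congr 2
  ext m
  by_cases h : m = 1
  · subst h
    simp [alphabetSeries]
  · have h' : ¬ 1 = m := fun e => h e.symm
    rw [alphabetSeries, map_sub, map_sub, PowerSeries.coeff_C_mul, PowerSeries.coeff_X, if_neg h]
    simp [h']

end Cascade

/-! ### Counting -/

section Counting

/-- Witt's formula, by Möbius inversion over the divisors in `[1, T]`. -/
theorem eq_sum_moebius {T : ℕ} {n : ℝ} {ℓ : ℕ → ℕ}
    (h : ∀ m ∈ Finset.Icc 1 T, ∑ i ∈ m.divisors, (i : ℝ) * ℓ i = n ^ m)
    {m : ℕ} (hm : m ∈ Finset.Icc 1 T) :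
    (ℓ m : ℝ) = (1 / (m : ℝ)) *
      ∑ d ∈ m.divisors, n ^ d * (ArithmeticFunction.moebius (m / d) : ℝ) := by
  have key := (ArithmeticFunction.sum_eq_iff_sum_mul_moebius_eq_on
    (f := fun i => (i : ℝ) * ℓ i) (g := fun m => n ^ m) {m | m ∈ Finset.Icc 1 T} (by
      intro a b hab hb
      simp only [Set.mem_ofPred_eq, Finset.mem_Icc] at hb ⊢
      exact ⟨Nat.pos_of_dvd_of_pos hab hb.1, (Nat.le_of_dvd hb.1 hab).trans hb.2⟩)).1
    (fun m _ hm => h m hm) m (Finset.mem_Icc.1 hm).1 hm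
  have hm0 : (m : ℝ) ≠ 0 := by
    have := (Finset.mem_Icc.1 hm).1
    positivity
  rw [Nat.sum_divisorsAntidiagonal' (fun a b => (ArithmeticFunction.moebius a : ℝ) * n ^ b)] at key
  simp_rw [mul_comm (n ^ _)]
  rw [key]
  field_simp

variable {T : ℕ} {n : ℕ} {ℓ : ℕ → ℕ}

theorem mul_le_pow (h : ∀ m ∈ Finset.Icc 1 T, ∑ i ∈ m.divisors, (i : ℝ) * ℓ i = (n : ℝ) ^ m)
    {m : ℕ} (hm : m ∈ Finset.Icc 1 T) : (m : ℝ) * ℓ m ≤ (n : ℝ) ^ m := by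
  rw [← h m hm]
  exact Finset.single_le_sum (f := fun i : ℕ => (i : ℝ) * ℓ i) (fun i _ => by positivity)
    (Nat.mem_divisors_self m (by have := (Finset.mem_Icc.1 hm).1; omega))

theorem sum_pow_Icc_le (hn : 2 ≤ n) (k : ℕ) :
    ∑ i ∈ Finset.Icc 1 k, (n : ℝ) ^ i ≤ (n : ℝ) ^ (k + 1) := by
  have hn' : (2 : ℝ) ≤ n := by exact_mod_cast hn
  induction k with
  | zero => simp
  | succ k ih =>
    rw [Finset.sum_Icc_succ_top (by omega)]
    have : (0 : ℝ) ≤ n ^ (k + 1) := by positivity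
    calc _ ≤ (n : ℝ) ^ (k + 1) + n ^ (k + 1) := by gcongr
      _ ≤ n ^ (k + 1 + 1) := by rw [pow_succ _ (k + 1)]; nlinarith

/-- The proper divisors of `m` are at most `m / 2`, so that their contribution to `n ^ m` is of
order `n ^ (m / 2)`. -/
theorem pow_le_two_mul (hn : 2 ≤ n)
    (h : ∀ m ∈ Finset.Icc 1 T, ∑ i ∈ m.divisors, (i : ℝ) * ℓ i = (n : ℝ) ^ m)
    {m : ℕ} (hm : m ∈ Finset.Icc 1 T) (hm4 : 4 ≤ m) : (n : ℝ) ^ m ≤ 2 * (m * ℓ m) := by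
  have hn' : (2 : ℝ) ≤ n := by exact_mod_cast hn
  have hT := (Finset.mem_Icc.1 hm).2
  have h1 : ∑ i ∈ m.properDivisors, (i : ℝ) * ℓ i ≤ (n : ℝ) ^ (m - 1) := by
    calc ∑ i ∈ m.properDivisors, (i : ℝ) * ℓ i
        ≤ ∑ i ∈ m.properDivisors, (n : ℝ) ^ i := by
          refine Finset.sum_le_sum fun i hi => mul_le_pow h ?_
          have := Nat.pos_of_mem_properDivisors hi
          have := (Nat.mem_properDivisors.1 hi).2
          exact Finset.mem_Icc.2 ⟨by omega, by omega⟩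
      _ ≤ ∑ i ∈ Finset.Icc 1 (m / 2), (n : ℝ) ^ i := by
          refine Finset.sum_le_sum_of_subset_of_nonneg (fun i hi => ?_) fun i _ _ => by positivity
          have h0 := Nat.pos_of_mem_properDivisors hi
          obtain ⟨⟨c, hc⟩, hlt⟩ := Nat.mem_properDivisors.1 hi
          have hc2 : 2 ≤ c := by
            by_contra! hc'
            interval_cases c <;> omega
          have : i * 2 ≤ m := hc ▸ Nat.mul_le_mul_left i hc2
          exact Finset.mem_Icc.2 ⟨h0, by omega⟩
      _ ≤ (n : ℝ) ^ (m / 2 + 1) := sum_pow_Icc_le hn _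
      _ ≤ (n : ℝ) ^ (m - 1) := pow_le_pow_right₀ (by linarith) (by omega)
  have h2 := h m hm
  rw [← Nat.cons_self_properDivisors (by omega), Finset.sum_cons] at h2
  have h3 : (n : ℝ) ^ m = n ^ (m - 1) * n := by rw [← pow_succ]; congr 1; omega
  have h4 : (0 : ℝ) ≤ n ^ (m - 1) := by positivity
  nlinarith

theorem sum_pow_div_le (hn : 2 ≤ n) (hT : 1 ≤ T) :
    ∑ m ∈ Finset.Icc 1 T, (n : ℝ) ^ m / m ≤ 4 * ((n : ℝ) ^ T / T) := by
  have hn' : (2 : ℝ) ≤ n := by exact_mod_cast hn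
  induction T, hT using Nat.le_induction with
  | base => simp; linarith
  | succ T hT ih =>
    rw [Finset.sum_Icc_succ_top (by omega)]
    rcases hT.eq_or_lt with rfl | hT2
    · norm_num
      nlinarith
    · -- the bound propagates because `4 (T + 1) ≤ 3 n T` for `T ≥ 2`
      have hT' : (2 : ℝ) ≤ T := by exact_mod_cast hT2
      have hpow : (0 : ℝ) < n ^ T := by positivity
      have : 4 * ((n : ℝ) ^ T / T) ≤ 3 * (n ^ (T + 1) / ((T + 1 : ℕ) : ℝ)) := by
        rw [mul_div_assoc', mul_div_assoc', div_le_div_iff₀ (by positivity) (by positivity)]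
        push_cast
        have : (4 : ℝ) * (T + 1) ≤ 3 * n * T := by nlinarith
        calc 4 * (n : ℝ) ^ T * (T + 1) = n ^ T * (4 * (T + 1)) := by ring
          _ ≤ n ^ T * (3 * n * T) := by gcongr
          _ = _ := by ring
      linarith

end Counting

section Growth

open StateSpace

variable (𝒜 : Type*) [Fintype 𝒜]

theorem totalDim_le (h𝒜 : 2 ≤ Fintype.card 𝒜) {T : ℕ} (hT : 1 ≤ T) :
    ((wordSSM 𝒜 T).totalDim : ℝ) ≤ 4 * ((Fintype.card 𝒜 : ℝ) ^ T / T) := by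
  obtain ⟨ℓ, hℓ, hsum⟩ := exists_totalDim_eq_sum 𝒜 T
  rw [hℓ, Nat.cast_sum]
  refine (Finset.sum_le_sum fun m hm => ?_).trans (sum_pow_div_le h𝒜 hT)
  have : (0 : ℝ) < m := by exact_mod_cast (Finset.mem_Icc.1 hm).1
  rw [le_div_iff₀ this, mul_comm]
  exact mul_le_pow hsum hm

theorem le_totalDim (h𝒜 : 2 ≤ Fintype.card 𝒜) {T : ℕ} (hT : 4 ≤ T) :
    (Fintype.card 𝒜 : ℝ) ^ T / T ≤ 2 * ((wordSSM 𝒜 T).totalDim : ℝ) := by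
  obtain ⟨ℓ, hℓ, hsum⟩ := exists_totalDim_eq_sum 𝒜 T
  have hTm : T ∈ Finset.Icc 1 T := Finset.mem_Icc.2 ⟨by omega, le_rfl⟩
  have h1 := pow_le_two_mul h𝒜 hsum hTm hT
  have h2 : ℓ T ≤ (wordSSM 𝒜 T).totalDim := by
    rw [hℓ]
    exact Finset.single_le_sum (fun _ _ => Nat.zero_le _) hTm
  have h3 : (ℓ T : ℝ) ≤ (wordSSM 𝒜 T).totalDim := by exact_mod_cast h2
  have h4 : (0 : ℝ) < T := by exact_mod_cast (by omega : 0 < T)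
  rw [div_le_iff₀ h4]
  nlinarith

theorem eventually_pow_le_totalDim (h𝒜 : 2 ≤ Fintype.card 𝒜) :
    ∀ᶠ T : ℕ in atTop, (3 / 2 : ℝ) ^ T ≤ ((wordSSM 𝒜 T).totalDim : ℝ) := by
  have hlim := tendsto_self_mul_const_pow_of_lt_one (r := (3 / 4 : ℝ)) (by norm_num) (by norm_num)
  filter_upwards [hlim.eventually (gt_mem_nhds (show (0 : ℝ) < 1 / 2 by norm_num)),
    eventually_ge_atTop 4] with T h1 hT
  have hn : (2 : ℝ) ≤ Fintype.card 𝒜 := by exact_mod_cast h𝒜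
  have h4 : (0 : ℝ) < T := by exact_mod_cast (by omega : 0 < T)
  have h5 := le_totalDim 𝒜 h𝒜 hT
  have h6 : (2 : ℝ) ^ T / T ≤ (Fintype.card 𝒜 : ℝ) ^ T / T := by gcongr
  have h7 : 2 * (3 / 2 : ℝ) ^ T ≤ 2 ^ T / T := by
    rw [le_div_iff₀ h4]
    have h8 : (3 / 2 : ℝ) ^ T = (3 / 4) ^ T * 2 ^ T := by rw [← mul_pow]; norm_num
    have h9 : (0 : ℝ) < 2 ^ T := by positivity
    rw [h8]
    nlinarith
  linarith

end Growth

end LazardElimination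

theorem mainTheorem6 (𝒜 : Type*) [Fintype 𝒜] (h𝒜 : 2 ≤ Fintype.card 𝒜) :
    (∀ T : ℕ, 1 ≤ T →
      (StateSpace.wordSSM 𝒜 T).IsAbelian ∧
      (StateSpace.wordSSM 𝒜 T).numLayers ≤ Nat.clog 2 T + 1 ∧
      ((StateSpace.wordSSM 𝒜 T).totalDim : ℝ) =
        ∑ m ∈ Finset.Icc 1 T, (1 / (m : ℝ)) *
          ∑ d ∈ m.divisors, (Fintype.card 𝒜 : ℝ) ^ d * (ArithmeticFunction.moebius (m / d) : ℝ)) ∧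
    (∃ c : ℝ, 1 < c ∧ ∀ᶠ T : ℕ in atTop, c ^ T ≤ ((StateSpace.wordSSM 𝒜 T).totalDim : ℝ)) ∧
    (fun T : ℕ => ((StateSpace.wordSSM 𝒜 T).totalDim : ℝ)) =Θ[atTop]
      (fun T : ℕ => (Fintype.card 𝒜 : ℝ) ^ T / (T : ℝ)) := by
  refine ⟨fun T hT => ⟨LazardElimination.isAbelian_wordSSM 𝒜 T,
    LazardElimination.numLayers_wordSSM_le 𝒜 T hT, ?_⟩,
    ⟨3 / 2, by norm_num, LazardElimination.eventually_pow_le_totalDim 𝒜 h𝒜⟩, ?_, ?_⟩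
  · obtain ⟨ℓ, hℓ, hsum⟩ := LazardElimination.exists_totalDim_eq_sum 𝒜 T
    rw [hℓ, Nat.cast_sum]
    exact Finset.sum_congr rfl fun m hm => LazardElimination.eq_sum_moebius hsum hm
  · refine IsBigO.of_bound 4 ?_
    filter_upwards [eventually_ge_atTop 1] with T hT
    rw [Real.norm_of_nonneg (by positivity), Real.norm_of_nonneg (by positivity)]
    exact LazardElimination.totalDim_le 𝒜 h𝒜 hT
  · refine IsBigO.of_bound 2 ?_
    filter_upwards [eventually_ge_atTop 4] with T hT
    rw [Real.norm_of_nonneg (by positivity), Real.norm_of_nonneg (by positivity)]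
    exact LazardElimination.le_totalDim 𝒜 h𝒜 hT
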